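/- For an entire function $f:\mathbb{C}\to\mathbb{C}$ let $CV(f)=\{f(z): f'(z)=0\}$ be its set of critical values, and let $AV(f)$ be its set of asymptotic values, i.e. of all $w\in\mathbb{C}$ for which there is a continuous path $\gamma:[0,\infty)\to\mathbb{C}$ with $\gamma(t)\to\infty$ and $f(\gamma(t))\to w$ as $t\to\infty$. Let $S(f)=\overline{AV(f)\cup CV(f)}$ (closure in $\mathbb{C}$) be the set of singular values of $f$. Equip the space $\mathcal{O}(\mathbb{C})$ of entire functions with the compact-open topology. Corollary. Let $U\subseteq\mathbb{C}$ be a closed set containing $0$. Then the family $\mathrm{Exp}=\{z\mapsto\lambda e^{z} : \lambda\in\mathbb{C}\}$ is contained in the closure, in $\mathcal{O}(\mathbb{C})$, of $\mathbb{S}_U=\{f\in\mathcal{O}(\mathbb{C}) : S(f)=U\}$. -/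

import Mathlib

open Filter Topology

/-- The space of entire functions, with the compact-open topology (the subspace topology
inherited from the space of continuous maps from the plane to itself). -/
abbrev EntireFunction : Type := {f : C(ℂ, ℂ) // Differentiable ℂ f}

namespace EntireFunction

/-- The critical values of `f`: the values of `f` at the zeros of its derivative. -/
def criticalValues (f : EntireFunction) : Set ℂ :=
  {w | ∃ z : ℂ, deriv f.1 z = 0 ∧ f.1 z = w}

/-- The (finite) asymptotic values of `f`: the limits of `f` along continuous paths
defined on `[0, ∞)` and tending to infinity. -/
def asymptoticValues (f : EntireFunction) : Set ℂ :=
  {w | ∃ γ : ℝ → ℂ, ContinuousOn γ (Set.Ici 0) ∧ Tendsto γ atTop (cocompact ℂ) ∧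
    Tendsto (fun t => f.1 (γ t)) atTop (𝓝 w)}

/-- The set `S(f)` of singular values of `f`. -/
def singularSet (f : EntireFunction) : Set ℂ :=
  closure (asymptoticValues f ∪ criticalValues f)

/-- The set of all entire functions whose set of singular values is exactly `U`. -/
def withSingularSet (U : Set ℂ) : Set EntireFunction :=
  {f | singularSet f = U}

/-- The function `z ↦ c * exp z`. -/
noncomputable def expScaled (c : ℂ) : EntireFunction :=
  ⟨⟨fun z => c * Complex.exp z, by fun_prop⟩, Complex.differentiable_exp.const_mul c⟩

/-- The exponential family: all functions `z ↦ c * exp z` with `c` a complex number. -/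
def expFamily : Set EntireFunction :=
  Set.range expScaled

end EntireFunction

/-! For `c ≠ 0`, approximate `c * exp z` by `c * exp (g z)` with `g` entire and close to the
identity on a large disc. Take `g` to be an infinite composition of the maps `z + a n * z ^ 2`. If
`P` is the composition of the first `n` factors, the critical values contributed by factor `n`
reduce to `P (-(1 / (4 * a n)))`. As `P` is onto and `exp` is periodic, `a n` can be arbitrarily
small while the exponential of this value is a prescribed nonzero number. So the critical values of
`c * exp g` can be made dense in `U \ {0}` (`exists_entire_near_id`).

The only asymptotic value is `0`. Along a path where `exp g` has a nonzero limit, `g` stays bounded,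
but the path must cross circles on which `g` is large (`asymptoticValues_expComp_subset`).
Conversely, a horizontal ray to the left that avoids the countably many critical values of `g` lifts
through `g`, and `exp g` tends to `0` along the lift (`zero_mem_asymptoticValues_expComp`). -/

/-- The quadratic polynomial `z + a * z ^ 2`, tangent to the identity at `0`. -/
def quad (a z : ℂ) : ℂ := z + a * z ^ 2

theorem hasDerivAt_quad (a z : ℂ) : HasDerivAt (quad a) (1 + 2 * a * z) z := by
  unfold quad
  convert! (hasDerivAt_id' z).add ((hasDerivAt_pow 2 z).const_mul a) using 1
  simp; ring

theorem differentiable_quad (a : ℂ) : Differentiable ℂ (quad a) :=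
  fun z => (hasDerivAt_quad a z).differentiableAt

theorem deriv_quad_eq_zero {a z : ℂ} (ha : a ≠ 0) :
    deriv (quad a) z = 0 ↔ z = -(1 / (2 * a)) := by
  rw [(hasDerivAt_quad a z).deriv]
  constructor
  · intro h
    field_simp
    linear_combination h
  · rintro rfl
    field_simp
    ring

theorem quad_critical {a : ℂ} (ha : a ≠ 0) : quad a (-(1 / (2 * a))) = -(1 / (4 * a)) := by
  unfold quad
  field_simp
  ring

theorem quad_surjective {a : ℂ} (ha : a ≠ 0) : Function.Surjective (quad a) := by
  intro w
  obtain ⟨s, hs⟩ := IsAlgClosed.exists_pow_nat_eq (1 + 4 * a * w) (n := 2) (by norm_num)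
  refine ⟨(s - 1) / (2 * a), ?_⟩
  unfold quad
  field_simp
  linear_combination hs

theorem tendsto_quad_cocompact {a : ℂ} (ha : a ≠ 0) :
    Tendsto (quad a) (cocompact ℂ) (cocompact ℂ) := by
  rw [← Metric.cobounded_eq_cocompact, ← tendsto_norm_atTop_iff_cobounded]
  have hn : Tendsto (fun z : ℂ => ‖z‖) (Bornology.cobounded ℂ) atTop :=
    tendsto_norm_cobounded_atTop
  refine tendsto_atTop_mono' _ ?_ hn
  filter_upwards [hn.eventually_ge_atTop (2 / ‖a‖)] with z hz
  have ha' : 0 < ‖a‖ := norm_pos_iff.2 ha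
  have h1 : 2 ≤ ‖a‖ * ‖z‖ := by
    rw [div_le_iff₀ ha'] at hz
    linarith
  have h2 : ‖a * z ^ 2‖ ≤ ‖quad a z‖ + ‖z‖ := by
    have : a * z ^ 2 = quad a z - z := by unfold quad; ring
    rw [this]
    exact norm_sub_le _ _
  rw [norm_mul, norm_pow] at h2
  nlinarith [norm_nonneg z]

theorem norm_quad_sub_self_le {a z : ℂ} {R : ℝ} (hz : ‖z‖ ≤ R) :
    ‖quad a z - z‖ ≤ ‖a‖ * R ^ 2 := by
  have : quad a z - z = a * z ^ 2 := by unfold quad; ring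
  rw [this, norm_mul, norm_pow]
  gcongr

theorem norm_quad_sub_quad_le {a x y : ℂ} {R : ℝ} (hR : 1 ≤ R) (ha : ‖a‖ * R ^ 2 ≤ 1 / 2)
    (hx : ‖x‖ ≤ R) (hy : ‖y‖ ≤ R) : ‖quad a x - quad a y‖ ≤ 2 * ‖x - y‖ := by
  have : quad a x - quad a y = (x - y) + a * (x + y) * (x - y) := by unfold quad; ring
  rw [this]
  refine (norm_add_le _ _).trans ?_
  rw [norm_mul, norm_mul]
  have h1 : ‖x + y‖ ≤ 2 * R := (norm_add_le _ _).trans (by linarith)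
  have h2 : ‖a‖ * ‖x + y‖ ≤ 1 := by
    calc ‖a‖ * ‖x + y‖ ≤ ‖a‖ * (2 * R) := by gcongr
      _ ≤ 2 * (‖a‖ * R ^ 2) := by nlinarith [norm_nonneg a, mul_nonneg (norm_nonneg a) (by linarith : (0:ℝ) ≤ R)]
      _ ≤ 1 := by linarith
  nlinarith [norm_nonneg (x - y)]

/-! ### Convergence of infinite compositions of quadratic maps -/

/-- The finite composition `quad (a n) ∘ quad (a (n + 1)) ∘ ⋯ ∘ quad (a (n + k - 1))`. -/
def quadComp (a : ℕ → ℂ) (n : ℕ) : ℕ → ℂ → ℂ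
  | 0 => id
  | k + 1 => quadComp a n k ∘ quad (a (n + k))

theorem quadComp_add (a : ℕ → ℂ) (n k l : ℕ) (z : ℂ) :
    quadComp a n (k + l) z = quadComp a n k (quadComp a (n + k) l z) := by
  induction l generalizing z with
  | zero => rfl
  | succ l ih =>
    rw [← add_assoc, quadComp, Function.comp_apply, ih, quadComp, Function.comp_apply, add_assoc]

theorem quadComp_one (a : ℕ → ℂ) (n : ℕ) (z : ℂ) : quadComp a n 1 z = quad (a n) z := rfl

theorem quadComp_succ' (a : ℕ → ℂ) (n k : ℕ) (z : ℂ) :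
    quadComp a n (k + 1) z = quad (a n) (quadComp a (n + 1) k z) := by
  rw [add_comm, quadComp_add, quadComp_one]

theorem differentiable_quadComp (a : ℕ → ℂ) (n k : ℕ) : Differentiable ℂ (quadComp a n k) := by
  induction k with
  | zero => exact differentiable_id
  | succ k ih => exact ih.comp (differentiable_quad _)

/-- Conditions on the coefficients `a n` which make the infinite composition of the maps
`quad (a n)` converge. -/
structure RapidDecay (a : ℕ → ℂ) (R : ℕ → ℝ) (δ : ℝ) : Prop where
  pos : 0 < δ
  le : δ ≤ 1 / 16
  two_le : ∀ n, 2 ≤ R n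
  add_one_le : ∀ n, R n + 1 ≤ R (n + 1)
  decay : ∀ n, ‖a n‖ * R n ^ 2 ≤ δ * (1 / 8) ^ n

namespace RapidDecay

variable {a : ℕ → ℂ} {R : ℕ → ℝ} {δ : ℝ} (H : RapidDecay a R δ)
include H

theorem bound_le (n : ℕ) : δ * (1 / 8) ^ n ≤ 1 / 16 := by
  have h1 : ((1 : ℝ) / 8) ^ n ≤ 1 := pow_le_one₀ (by norm_num) (by norm_num)
  nlinarith [H.pos, H.le]

theorem monotone : Monotone R := monotone_nat_of_le_succ fun n => by linarith [H.add_one_le n]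

theorem le_radius (n : ℕ) : (n : ℝ) + 2 ≤ R n := by
  induction n with
  | zero => simpa using H.two_le 0
  | succ n ih => push_cast; linarith [H.add_one_le n]

theorem norm_quadComp_sub_self_le (k n : ℕ) {z : ℂ} (hz : ‖z‖ ≤ R n - 1) :
    ‖quadComp a n k z - z‖ ≤ 2 * (δ * (1 / 8) ^ n) := by
  induction k generalizing n with
  | zero =>
    have := H.pos
    simp only [quadComp, id, sub_self, norm_zero]
    positivity
  | succ k ih =>
    rw [quadComp_succ']
    have h1 := ih (n + 1) (hz.trans (by linarith [H.add_one_le n]))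
    have h2 := H.bound_le (n + 1)
    have h3 : ‖quadComp a (n + 1) k z‖ ≤ R n := by
      have := norm_le_norm_add_norm_sub' (quadComp a (n + 1) k z) z
      linarith
    have h4 := (norm_quad_sub_self_le (a := a n) h3).trans (H.decay n)
    have h5 := norm_sub_le_norm_sub_add_norm_sub (quad (a n) (quadComp a (n + 1) k z))
      (quadComp a (n + 1) k z) z
    rw [pow_succ] at h1
    have : 0 < δ * (1 / 8) ^ n := mul_pos H.pos (by positivity)
    linarith

theorem norm_quadComp_sub_le (k n : ℕ) {x y : ℂ} (hx : ‖x‖ ≤ R n - 1) (hy : ‖y‖ ≤ R n - 1) :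
    ‖quadComp a n k x - quadComp a n k y‖ ≤ 2 ^ k * ‖x - y‖ := by
  induction k generalizing n with
  | zero => simp [quadComp]
  | succ k ih =>
    rw [quadComp_succ', quadComp_succ', pow_succ']
    have hx' : ‖x‖ ≤ R (n + 1) - 1 := hx.trans (by linarith [H.add_one_le n])
    have hy' : ‖y‖ ≤ R (n + 1) - 1 := hy.trans (by linarith [H.add_one_le n])
    have key : ∀ w : ℂ, ‖w‖ ≤ R n - 1 → ‖quadComp a (n + 1) k w‖ ≤ R n := fun w hw => by
      have h1 := norm_le_norm_add_norm_sub' (quadComp a (n + 1) k w) w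
      have h2 := H.norm_quadComp_sub_self_le k (n + 1) (z := w)
        (hw.trans (by linarith [H.add_one_le n]))
      linarith [H.bound_le (n + 1)]
    have := norm_quad_sub_quad_le (a := a n) (by linarith [H.two_le n])
      ((H.decay n).trans ((H.bound_le n).trans (by norm_num))) (key x hx) (key y hy)
    have := ih (n + 1) hx' hy'
    rw [mul_assoc]
    linarith

/-- The new innermost factor moves `z` by at most `δ * (1 / 8) ^ (n + k)`, and the outer composition
expands distances by at most `2 ^ k`. -/
theorem dist_quadComp_succ_le (n k : ℕ) {z : ℂ} (hz : ‖z‖ ≤ R n - 2) :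
    dist (quadComp a n k z) (quadComp a n (k + 1) z) ≤ 1 * (1 / 2) ^ k := by
  have hmono := H.monotone (Nat.le_add_right n k)
  have h1 : ‖quad (a (n + k)) z - z‖ ≤ δ * (1 / 8) ^ (n + k) :=
    (norm_quad_sub_self_le (hz.trans (by linarith))).trans (H.decay _)
  have h2 := H.bound_le (n + k)
  have h3 : ‖quad (a (n + k)) z‖ ≤ R n - 1 := by
    have := norm_le_norm_add_norm_sub' (quad (a (n + k)) z) z
    linarith
  rw [dist_comm, dist_eq_norm, quadComp, Function.comp_apply]
  refine (H.norm_quadComp_sub_le k n h3 (by linarith)).trans ?_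
  calc (2 : ℝ) ^ k * ‖quad (a (n + k)) z - z‖ ≤ 2 ^ k * (1 * (1 / 4) ^ k) := by
        gcongr
        refine h1.trans ?_
        have e1 : ((1 : ℝ) / 8) ^ (n + k) ≤ (1 / 8) ^ k :=
          pow_le_pow_of_le_one (by norm_num) (by norm_num) (by omega)
        have e2 : ((1 : ℝ) / 8) ^ k ≤ (1 / 4) ^ k := by gcongr; norm_num
        have := H.pos
        have := H.le
        have : (0 : ℝ) ≤ (1 / 8) ^ (n + k) := by positivity
        nlinarith
    _ = 1 * (1 / 2) ^ k := by
        rw [one_mul, one_mul, ← mul_pow]; norm_num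

theorem exists_limit_near (n : ℕ) {z : ℂ} (hz : ‖z‖ ≤ R n - 2) :
    ∃ w, Tendsto (fun k => quadComp a n k z) atTop (𝓝 w) :=
  cauchySeq_tendsto_of_complete
    (cauchySeq_of_le_geometric (1 / 2) 1 (by norm_num) fun k => H.dist_quadComp_succ_le n k hz)

theorem exists_index (r : ℝ) (n : ℕ) : ∃ k : ℕ, r ≤ R (n + k) - 2 := by
  obtain ⟨k, hk⟩ := exists_nat_ge r
  refine ⟨k, ?_⟩
  have := H.le_radius (n + k)
  push_cast at this
  have : (0 : ℝ) ≤ n := Nat.cast_nonneg n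
  linarith

theorem exists_limit (n : ℕ) (z : ℂ) :
    ∃ w, Tendsto (fun k => quadComp a n k z) atTop (𝓝 w) := by
  -- Far enough along, `z` lies in the disc where the tail converges; the first `m` maps are then
  -- applied to the tail limit.
  obtain ⟨m, hm⟩ := H.exists_index ‖z‖ n
  obtain ⟨w, hw⟩ := H.exists_limit_near (n + m) hm
  refine ⟨quadComp a n m w, ?_⟩
  rw [← tendsto_add_atTop_iff_nat m]
  have := ((differentiable_quadComp a n m).continuous.tendsto w).comp hw
  refine this.congr fun k => ?_
  rw [Function.comp_apply, ← quadComp_add, add_comm]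

end RapidDecay

/-- The infinite composition `quad (a n) ∘ quad (a (n + 1)) ∘ ⋯`, where it converges. -/
noncomputable def quadLim (a : ℕ → ℂ) (n : ℕ) (z : ℂ) : ℂ :=
  limUnder atTop fun k => quadComp a n k z

namespace RapidDecay

variable {a : ℕ → ℂ} {R : ℕ → ℝ} {δ : ℝ} (H : RapidDecay a R δ)
include H

theorem tendsto_quadLim (n : ℕ) (z : ℂ) :
    Tendsto (fun k => quadComp a n k z) atTop (𝓝 (quadLim a n z)) :=
  tendsto_nhds_limUnder (H.exists_limit n z)

theorem quadLim_eq (n k : ℕ) (z : ℂ) :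
    quadLim a n z = quadComp a n k (quadLim a (n + k) z) := by
  have h1 := (tendsto_add_atTop_iff_nat k).2 (H.tendsto_quadLim n z)
  have h2 := ((differentiable_quadComp a n k).continuous.tendsto _).comp
    (H.tendsto_quadLim (n + k) z)
  refine tendsto_nhds_unique h1 (h2.congr fun l => ?_)
  rw [Function.comp_apply, ← quadComp_add, add_comm]

theorem norm_quadLim_sub_self_le (n : ℕ) {z : ℂ} (hz : ‖z‖ ≤ R n - 1) :
    ‖quadLim a n z - z‖ ≤ 2 * (δ * (1 / 8) ^ n) :=
  le_of_tendsto ((H.tendsto_quadLim n z).sub_const z).norm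
    (Eventually.of_forall fun k => H.norm_quadComp_sub_self_le k n hz)

theorem norm_quadLim_sub_self_le' (n : ℕ) {z : ℂ} (hz : ‖z‖ ≤ R n - 1) :
    ‖quadLim a n z - z‖ ≤ 1 / 8 :=
  (H.norm_quadLim_sub_self_le n hz).trans (by linarith [H.bound_le n])

theorem differentiableOn_quadLim (n : ℕ) :
    DifferentiableOn ℂ (quadLim a n) (Metric.ball 0 (R n - 2)) := by
  have hu : TendstoUniformlyOn (quadComp a n) (quadLim a n) atTop (Metric.ball 0 (R n - 2)) := by
    rw [Metric.tendstoUniformlyOn_iff]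
    intro e he
    have h0 : Tendsto (fun k : ℕ => (1 : ℝ) * (1 / 2) ^ k / (1 - 1 / 2)) atTop (𝓝 0) := by
      have := ((tendsto_pow_atTop_nhds_zero_of_lt_one (by norm_num : (0 : ℝ) ≤ 1 / 2)
        (by norm_num)).const_mul 1).div_const (1 - 1 / 2)
      simpa using this
    filter_upwards [h0.eventually_lt_const he] with k hk z hz
    rw [mem_ball_zero_iff] at hz
    rw [dist_comm]
    exact (dist_le_of_le_geometric_of_tendsto (1 / 2) 1 (by norm_num)
      (fun k => H.dist_quadComp_succ_le n k hz.le) (H.tendsto_quadLim n z) k).trans_lt hk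
  exact hu.tendstoLocallyUniformlyOn.differentiableOn
    (Eventually.of_forall fun k => (differentiable_quadComp a n k).differentiableOn)
    Metric.isOpen_ball

theorem differentiable_quadLim (n : ℕ) : Differentiable ℂ (quadLim a n) := by
  intro z
  obtain ⟨m, hm⟩ := H.exists_index (‖z‖ + 1) n
  have h1 : DifferentiableAt ℂ (quadLim a (n + m)) z :=
    (H.differentiableOn_quadLim (n + m)).differentiableAt
      (Metric.isOpen_ball.mem_nhds (by rw [mem_ball_zero_iff]; linarith))
  have h2 : quadLim a n = quadComp a n m ∘ quadLim a (n + m) := funext (H.quadLim_eq n m)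
  rw [h2]
  exact (differentiable_quadComp a n m _).comp z h1

theorem deriv_quadLim_ne_zero (n : ℕ) {z : ℂ} (hz : ‖z‖ ≤ R n - 2) :
    deriv (quadLim a n) z ≠ 0 := by
  have hd := H.differentiable_quadLim n
  -- Cauchy's estimate on the unit circle about `z` puts the derivative within `1 / 8` of `1`.
  have h1 : ‖deriv (fun w => quadLim a n w - w) z‖ ≤ (1 / 8) / 1 := by
    refine Complex.norm_deriv_le_of_forall_mem_sphere_norm_le one_pos
      (hd.sub differentiable_id).diffContOnCl fun w hw => ?_
    refine H.norm_quadLim_sub_self_le' n ?_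
    rw [mem_sphere_iff_norm] at hw
    have := norm_le_norm_add_norm_sub' w z
    linarith
  intro h0
  rw [deriv_fun_sub (hd z) differentiableAt_fun_id, h0] at h1
  norm_num at h1

theorem exists_quadLim_eq (n : ℕ) {w : ℂ} (hw : ‖w‖ ≤ R n - 3) :
    ∃ z, ‖z‖ ≤ R n - 2 ∧ quadLim a n z = w := by
  have hd := (H.differentiable_quadLim n).diffContOnCl (s := Metric.ball w 1)
  have hn : ∀ z : ℂ, ‖z - w‖ ≤ 1 → ‖z‖ ≤ R n - 2 := fun z hz => by
    have := norm_le_norm_add_norm_sub' z w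
    linarith
  have hww := H.norm_quadLim_sub_self_le' n (z := w) (by linarith)
  have hs : ∀ z ∈ Metric.sphere w 1, (3 : ℝ) / 4 ≤ ‖quadLim a n z - quadLim a n w‖ := by
    intro z hz
    rw [mem_sphere_iff_norm] at hz
    have h1 := H.norm_quadLim_sub_self_le' n (z := z) (by linarith [hn z hz.le])
    have h2 : z - w = (quadLim a n z - quadLim a n w) + (quadLim a n w - w)
      - (quadLim a n z - z) := by ring
    have h3 := norm_sub_le ((quadLim a n z - quadLim a n w) + (quadLim a n w - w))
      (quadLim a n z - z)
    have h4 := norm_add_le (quadLim a n z - quadLim a n w) (quadLim a n w - w)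
    rw [← h2, hz] at h3
    linarith
  have hf : ∃ᶠ z in 𝓝 w, quadLim a n z ≠ quadLim a n w := by
    intro hev
    have hev' : quadLim a n =ᶠ[𝓝 w] fun _ => quadLim a n w :=
      hev.mono fun z hz => not_not.1 hz
    refine H.deriv_quadLim_ne_zero n (z := w) (by linarith) ?_
    rw [hev'.deriv_eq, deriv_const]
  -- The quantitative open mapping theorem covers a disc of radius `3 / 8` about `quadLim a n w`,
  -- which lies within `1 / 8` of `w`.
  obtain ⟨z, hz, hzw⟩ := hd.ball_subset_image_closedBall one_pos hs hf
    (show w ∈ _ by rw [Metric.mem_ball, dist_comm, dist_eq_norm]; linarith)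
  refine ⟨z, hn z ?_, hzw⟩
  rwa [← mem_closedBall_iff_norm]

end RapidDecay

/-! ### Choice of the coefficients -/

theorem Filter.Tendsto.exists_norm_le {P : ℂ → ℂ} (hP : Tendsto P (cocompact ℂ) (cocompact ℂ))
    (M : ℝ) : ∃ r : ℝ, ∀ w, r ≤ ‖w‖ → M ≤ ‖P w‖ := by
  rw [← Metric.cobounded_eq_cocompact] at hP
  have h := (tendsto_norm_cobounded_atTop.comp hP).eventually_ge_atTop M
  obtain ⟨r, -, hr⟩ := (Filter.hasBasis_cobounded_norm (E := ℂ)).eventually_iff.1 h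
  exact ⟨r, fun w hw => hr hw⟩

/-- The logarithms of `u` are unbounded, whereas `P` is bounded on each disc, so preimages of
suitable logarithms lie far out. -/
theorem exists_large_exp_eq {P : ℂ → ℂ} (hc : Continuous P) (hs : Function.Surjective P)
    {u : ℂ} (hu : u ≠ 0) (r : ℝ) : ∃ w, r ≤ ‖w‖ ∧ Complex.exp (P w) = u := by
  obtain ⟨C, hC⟩ := (isCompact_closedBall (0 : ℂ) r).exists_bound_of_continuousOn hc.continuousOn
  obtain ⟨k, hk⟩ := exists_nat_gt (C + ‖Complex.log u‖)
  obtain ⟨w, hw⟩ := hs (Complex.log u + k * (2 * Real.pi * Complex.I))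
  refine ⟨w, ?_, by rw [hw, Complex.exp_periodic.nat_mul k (Complex.log u), Complex.exp_log hu]⟩
  by_contra! hlt
  have h1 := hC w (by simpa using hlt.le)
  rw [hw] at h1
  have h2 := norm_sub_le (Complex.log u + k * (2 * Real.pi * Complex.I)) (Complex.log u)
  rw [add_sub_cancel_left] at h2
  have h3 : ‖(k : ℂ) * (2 * Real.pi * Complex.I)‖ = k * (2 * Real.pi) := by
    simp [abs_of_pos Real.pi_pos]
  have : (k : ℝ) ≤ k * (2 * Real.pi) := by
    have := Real.pi_gt_three
    nlinarith [Nat.cast_nonneg (α := ℝ) k]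
  linarith

theorem exists_quad_parameters {P : ℂ → ℂ} (hc : Continuous P) (hs : Function.Surjective P)
    (hP : Tendsto P (cocompact ℂ) (cocompact ℂ)) {u : ℂ} (hu : u ≠ 0) (S M : ℝ) {η : ℝ}
    (hη : 0 < η) : ∃ (R : ℝ) (a : ℂ), S ≤ R ∧ (∀ w, R - 3 ≤ ‖w‖ → M ≤ ‖P w‖) ∧ a ≠ 0 ∧
      ‖a‖ * R ^ 2 ≤ η ∧ Complex.exp (P (-(1 / (4 * a)))) = u := by
  obtain ⟨r, hr⟩ := hP.exists_norm_le M
  -- The radius is fixed first; `w` is the future critical value `-(1 / (4 * a))`, and its size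
  -- makes `a` small.
  obtain ⟨w, hw, hwu⟩ := exists_large_exp_eq hc hs hu ((max S (r + 3)) ^ 2 / η + 1)
  have hw1 : 1 ≤ ‖w‖ := le_trans (by linarith [show 0 ≤ (max S (r + 3)) ^ 2 / η by positivity]) hw
  have hw0 : w ≠ 0 := norm_pos_iff.1 (by linarith)
  refine ⟨max S (r + 3), -(1 / (4 * w)), le_max_left _ _, fun w hw => hr w ?_, ?_, ?_, ?_⟩
  · linarith [le_max_right S (r + 3)]
  · simpa using hw0
  · have h1 : (max S (r + 3)) ^ 2 ≤ ‖w‖ * η := by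
      rw [← div_le_iff₀ hη]; linarith
    have h2 : ‖-(1 / (4 * w))‖ = 1 / (4 * ‖w‖) := by simp
    rw [h2, one_div_mul_eq_div, div_le_iff₀ (by linarith)]
    nlinarith
  · rw [← hwu]
    congr 2
    field_simp

theorem exists_rapidDecay_sequence {u : ℕ → ℂ} (hu : ∀ n, u n ≠ 0) (R₀ : ℝ) {δ : ℝ} (hδ : 0 < δ)
    (hδ' : δ ≤ 1 / 16) : ∃ (a : ℕ → ℂ) (R : ℕ → ℝ), RapidDecay a R δ ∧ R₀ ≤ R 0 ∧
      (∀ n, a n ≠ 0) ∧ (∀ n, ‖-(1 / (2 * a n))‖ ≤ R (n + 1) - 3) ∧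
      (∀ n w, R n - 3 ≤ ‖w‖ → (n : ℝ) ≤ ‖quadComp a 0 n w‖) ∧
      ∀ n, Complex.exp (quadComp a 0 n (-(1 / (4 * a n)))) = u n := by
  let X := {P : ℂ → ℂ // Continuous P ∧ Function.Surjective P ∧
    Tendsto P (cocompact ℂ) (cocompact ℂ)}
  have step : ∀ (n : ℕ) (x : X × ℝ), ∃ (R : ℝ) (a : ℂ), x.2 ≤ R ∧
      (∀ w, R - 3 ≤ ‖w‖ → (n : ℝ) ≤ ‖x.1.1 w‖) ∧ a ≠ 0 ∧ ‖a‖ * R ^ 2 ≤ δ * (1 / 8) ^ n ∧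
      Complex.exp (x.1.1 (-(1 / (4 * a)))) = u n := fun n x =>
    exists_quad_parameters x.1.2.1 x.1.2.2.1 x.1.2.2.2 (hu n) x.2 n (by positivity)
  choose R a h1 h2 h3 h4 h5 using step
  -- The state holds the current composition and a lower bound for the next radius. That bound puts
  -- the critical point of factor `n` well inside the disc where the next tail is nearly the
  -- identity, so the tail attains it.
  let s : ℕ → X × ℝ := fun n => Nat.rec
    (⟨id, continuous_id, Function.surjective_id, tendsto_id⟩, max R₀ 2)
    (fun n x => (⟨x.1.1 ∘ quad (a n x),
      x.1.2.1.comp (differentiable_quad _).continuous,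
      x.1.2.2.1.comp (quad_surjective (h3 n x)),
      x.1.2.2.2.comp (tendsto_quad_cocompact (h3 n x))⟩,
      max (R n x + 1) (‖-(1 / (2 * a n x))‖ + 3))) n
  have hs : ∀ n, (s (n + 1)).2 = max (R n (s n) + 1) (‖-(1 / (2 * a n (s n)))‖ + 3) :=
    fun n => rfl
  have hcomp : ∀ n, quadComp (fun n => a n (s n)) 0 n = (s n).1.1 := by
    intro n
    induction n with
    | zero => rfl
    | succ n ih =>
      rw [quadComp, ih, zero_add]
  have hR0 : max R₀ 2 ≤ R 0 (s 0) := h1 0 (s 0)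
  have hstep : ∀ n, R n (s n) + 1 ≤ R (n + 1) (s (n + 1)) := fun n =>
    (le_max_left _ _).trans ((hs n).symm.le.trans (h1 (n + 1) (s (n + 1))))
  refine ⟨fun n => a n (s n), fun n => R n (s n), ⟨hδ, hδ', fun n => ?_, hstep, fun n => h4 _ _⟩,
    (le_max_left _ _).trans hR0, fun n => h3 _ _, fun n => ?_, fun n => ?_, fun n => ?_⟩
  · induction n with
    | zero => exact (le_max_right _ _).trans hR0
    | succ n ih => linarith [hstep n]
  · have := (le_max_right _ _).trans ((hs n).symm.le.trans (h1 (n + 1) (s (n + 1))))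
    linarith
  · rw [hcomp]
    exact h2 _ _
  · rw [hcomp]
    exact h5 _ _

theorem exists_of_deriv_quadComp_eq_zero {a : ℕ → ℂ} (ha : ∀ n, a n ≠ 0) {n : ℕ} {w : ℂ}
    (hw : deriv (quadComp a 0 n) w = 0) :
    ∃ k, quadComp a 0 n w = quadComp a 0 k (-(1 / (4 * a k))) := by
  induction n generalizing w with
  | zero => simp [quadComp] at hw
  | succ n ih =>
    rw [quadComp, zero_add] at hw ⊢
    rw [deriv_comp _ (differentiable_quadComp a 0 n _) (differentiable_quad _ _),
      mul_eq_zero, deriv_quad_eq_zero (ha n)] at hw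
    rcases hw with hw | rfl
    · exact ih hw
    · exact ⟨n, by rw [Function.comp_apply, quad_critical (ha n)]⟩

/-- The function `g` has arbitrarily large modulus on suitable arbitrarily large circles
centred at `0`. -/
def LargeOnCircles (g : ℂ → ℂ) : Prop :=
  ∀ M : ℝ, ∃ r : ℝ, M ≤ r ∧ ∀ z, ‖z‖ = r → M ≤ ‖g z‖

/-- There are entire functions close to the identity on a given disc, large on arbitrarily large
circles, and such that the exponentials of their critical values form a prescribed countable set
of nonzero numbers. -/
theorem exists_entire_near_id {u : ℕ → ℂ} (hu : ∀ n, u n ≠ 0) (R₀ : ℝ) {δ : ℝ} (hδ : 0 < δ) :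
    ∃ g : ℂ → ℂ, Differentiable ℂ g ∧ (∀ z, ‖z‖ ≤ R₀ → ‖g z - z‖ ≤ δ) ∧ LargeOnCircles g ∧
      {w | ∃ z, deriv g z = 0 ∧ g z = w}.Countable ∧
      {w | ∃ z, deriv g z = 0 ∧ Complex.exp (g z) = w} = Set.range u := by
  obtain ⟨a, R, H, hR0, ha, haR, hlarge, hexp⟩ := exists_rapidDecay_sequence hu (R₀ + 1)
    (δ := min (δ / 2) (1 / 16)) (by positivity) (min_le_right _ _)
  have hfac : ∀ n, quadLim a 0 = quadComp a 0 n ∘ quadLim a n := fun n => funext fun z => by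
    simpa using H.quadLim_eq 0 n z
  have hderiv : ∀ n z, deriv (quadLim a 0) z =
      deriv (quadComp a 0 n) (quadLim a n z) * deriv (quadLim a n) z := fun n z => by
    rw [hfac n]
    exact deriv_comp z (differentiable_quadComp a 0 n _) (H.differentiable_quadLim n z)
  have hcrit : ∀ z, deriv (quadLim a 0) z = 0 →
      ∃ k, quadLim a 0 z = quadComp a 0 k (-(1 / (4 * a k))) := by
    intro z hz
    obtain ⟨n, hn⟩ := H.exists_index ‖z‖ 0
    rw [zero_add] at hn
    rw [hderiv n, mul_eq_zero, or_iff_left (H.deriv_quadLim_ne_zero n hn)] at hz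
    rw [hfac n]
    exact exists_of_deriv_quadComp_eq_zero ha hz
  have hcrit' : ∀ k, ∃ z, deriv (quadLim a 0) z = 0 ∧
      quadLim a 0 z = quadComp a 0 k (-(1 / (4 * a k))) := by
    intro k
    obtain ⟨z, -, hz⟩ := H.exists_quadLim_eq (k + 1) (haR k)
    refine ⟨z, ?_, ?_⟩
    · rw [hderiv (k + 1), hz, quadComp, zero_add,
        deriv_comp _ (differentiable_quadComp a 0 k _) (differentiable_quad _ _),
        (deriv_quad_eq_zero (ha k)).2 rfl, mul_zero, zero_mul]
    · rw [hfac (k + 1), Function.comp_apply, hz, quadComp, zero_add, Function.comp_apply,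
        quad_critical (ha k)]
  refine ⟨quadLim a 0, H.differentiable_quadLim 0, fun z hz => ?_, fun M => ?_, ?_, ?_⟩
  · have := H.norm_quadLim_sub_self_le 0 (z := z) (by linarith)
    rw [pow_zero, mul_one] at this
    linarith [min_le_left (δ / 2) (1 / 16)]
  · obtain ⟨n, hn⟩ := exists_nat_ge M
    have hRn := H.le_radius n
    refine ⟨R n - 2, by linarith, fun z hz => hn.trans ?_⟩
    rw [hfac n]
    refine hlarge n _ ?_
    have h1 := H.norm_quadLim_sub_self_le' n (z := z) (by linarith)
    have h2 := norm_sub_norm_le z (quadLim a n z)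
    rw [norm_sub_rev] at h2
    linarith
  · refine (Set.countable_range fun k => quadComp a 0 k (-(1 / (4 * a k)))).mono ?_
    rintro _ ⟨z, hz, rfl⟩
    obtain ⟨k, hk⟩ := hcrit z hz
    exact ⟨k, hk.symm⟩
  · ext w
    constructor
    · rintro ⟨z, hz, rfl⟩
      obtain ⟨k, hk⟩ := hcrit z hz
      exact ⟨k, by rw [hk, hexp]⟩
    · rintro ⟨k, rfl⟩
      obtain ⟨z, hz, hk⟩ := hcrit' k
      exact ⟨z, hz, by rw [hk, hexp]⟩

/-! ### Lifting horizontal rays -/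

theorem isLocalHomeomorphOn_subtypeVal {X : Type*} [TopologicalSpace X] (K : Set X) :
    IsLocalHomeomorphOn (Subtype.val : K → X) (Subtype.val ⁻¹' interior K) := by
  rw [isLocalHomeomorphOn_iff_isOpenEmbedding_restrict]
  intro x hx
  have hopen : IsOpen (Subtype.val ⁻¹' interior K : Set K) :=
    isOpen_interior.preimage continuous_subtype_val
  refine ⟨_, hopen.mem_nhds hx, Topology.IsEmbedding.subtypeVal.comp .subtypeVal, ?_⟩
  convert! isOpen_interior (s := K) using 1
  ext y
  constructor
  · rintro ⟨⟨z, hz⟩, rfl⟩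
    exact hz
  · exact fun hy => ⟨⟨⟨y, interior_subset hy⟩, hy⟩, rfl⟩

/-- Compactness of the disc supplies properness, and `hr` keeps the fibres over `s` off the boundary
circle, so a local homeomorphism there is a covering. -/
theorem isCoveringMapOn_closedBall {g : ℂ → ℂ} (hg : Differentiable ℂ g) {r : ℝ} {s : Set ℂ}
    (hr : ∀ z, ‖z‖ = r → g z ∉ s) (hs : ∀ z, g z ∈ s → deriv g z ≠ 0) :
    IsCoveringMapOn (fun z : Metric.closedBall (0 : ℂ) r => g z) s := by
  have : CompactSpace (Metric.closedBall (0 : ℂ) r) :=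
    isCompact_iff_compactSpace.1 (isCompact_closedBall _ _)
  refine .of_isLocalHomeomorphOn (hg.continuous.comp continuous_subtype_val) ?_
  have h1 : IsLocalHomeomorphOn g (g ⁻¹' s) := fun z hz =>
    ⟨_, ((hg.contDiff (n := 1)).contDiffAt.hasStrictDerivAt one_ne_zero
      |>.hasStrictFDerivAt_equiv (hs z hz)).mem_toOpenPartialHomeomorph_source, by simp⟩
  refine (h1.comp ((isLocalHomeomorphOn_subtypeVal (Metric.closedBall (0 : ℂ) r)).mono
    fun z hz => ?_) fun z hz => hz)
  rw [Set.mem_preimage]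
  refine Metric.ball_subset_interior_closedBall ?_
  rw [mem_ball_zero_iff]
  exact lt_of_le_of_ne (mem_closedBall_zero_iff.1 z.2) fun h => hr z h hz

section RayLifting

variable {g : ℂ → ℂ} (hg : Differentiable ℂ g) (hl : LargeOnCircles g) {z₀ : ℂ}
  (hz : ∀ z (t : ℝ), g z = g z₀ - t → deriv g z ≠ 0)
include hg hl hz

/-- On the chosen circle `|g|` exceeds every modulus on the segment. The free bound `C` lets two
given lifts be placed in one disc and compared. -/
theorem existsUnique_lift_segment {T : ℝ} (hT : 0 ≤ T) (C : ℝ) :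
    ∃ r, C ≤ r ∧ ∃! F : C(ℝ, Metric.closedBall (0 : ℂ) r),
      (F 0 : ℂ) = z₀ ∧ ∀ t, g (F t) = g z₀ - (Set.projIcc 0 T hT t : ℝ) := by
  obtain ⟨r, hr, hlarge⟩ := hl (max C (max ‖z₀‖ (‖g z₀‖ + T + 1)))
  have hr1 : C ≤ r := (le_max_left _ _).trans hr
  have hr2 : ‖z₀‖ ≤ r := (le_max_left _ _).trans ((le_max_right _ _).trans hr)
  let s : Set ℂ := Set.range fun t : ℝ => g z₀ - (Set.projIcc 0 T hT t : ℝ)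
  have hcov : IsCoveringMapOn (fun z : Metric.closedBall (0 : ℂ) r => g z) s := by
    refine isCoveringMapOn_closedBall hg ?_ ?_
    · rintro z hzr ⟨t, ht⟩
      have h1 := (le_max_right _ _).trans ((le_max_right _ _).trans (hlarge z hzr))
      have h2 := norm_sub_le (g z₀) ((Set.projIcc 0 T hT t : ℝ) : ℂ)
      have h3 := (Set.projIcc 0 T hT t).2
      dsimp only at ht
      rw [ht, Complex.norm_real, Real.norm_of_nonneg h3.1] at h2
      linarith [h3.2]
    · rintro z ⟨t, ht⟩
      exact hz z _ ht.symm
  have hcont : Continuous fun t : ℝ => g z₀ - ((Set.projIcc 0 T hT t : ℝ) : ℂ) :=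
    continuous_const.sub (Complex.continuous_ofReal.comp
      (continuous_subtype_val.comp continuous_projIcc))
  obtain ⟨F, ⟨hF0, hF⟩, huniq⟩ := hcov.existsUnique_continuousMap_lifts
    (⟨_, hcont⟩ : C(ℝ, ℂ)) (a₀ := 0) (e₀ := ⟨z₀, mem_closedBall_zero_iff.2 hr2⟩)
    (by simp) fun t => ⟨t, rfl⟩
  refine ⟨r, hr1, F, ⟨by rw [hF0], fun t => congrFun hF t⟩, ?_⟩
  rintro G ⟨hG0, hG⟩
  exact huniq G ⟨Subtype.ext hG0, funext hG⟩

theorem exists_lift_segment {T : ℝ} (hT : 0 ≤ T) :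
    ∃ γ : ℝ → ℂ, Continuous γ ∧ γ 0 = z₀ ∧ ∀ t ∈ Set.Icc 0 T, g (γ t) = g z₀ - t := by
  obtain ⟨r, -, F, ⟨hF0, hF⟩, -⟩ := existsUnique_lift_segment hg hl hz hT 0
  refine ⟨fun t => F t, continuous_subtype_val.comp F.continuous, hF0, fun t ht => ?_⟩
  rw [hF, Set.projIcc_of_mem hT ht]

theorem lift_segment_unique {T : ℝ} (hT : 0 ≤ T) {γ η : ℝ → ℂ} (hγ : Continuous γ)
    (hη : Continuous η) (hγ0 : γ 0 = z₀) (hη0 : η 0 = z₀)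
    (hγg : ∀ t ∈ Set.Icc 0 T, g (γ t) = g z₀ - t) (hηg : ∀ t ∈ Set.Icc 0 T, g (η t) = g z₀ - t) :
    Set.EqOn γ η (Set.Icc 0 T) := by
  obtain ⟨C, hC⟩ := isCompact_Icc.exists_bound_of_continuousOn (s := Set.Icc 0 T) hγ.continuousOn
  obtain ⟨D, hD⟩ := isCompact_Icc.exists_bound_of_continuousOn (s := Set.Icc 0 T) hη.continuousOn
  obtain ⟨r, hr, F, -, huniq⟩ := existsUnique_lift_segment hg hl hz hT (max C D)
  have key : ∀ ζ : ℝ → ℂ, Continuous ζ → ζ 0 = z₀ → (∀ t ∈ Set.Icc 0 T, g (ζ t) = g z₀ - t) →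
      (∀ t ∈ Set.Icc 0 T, ‖ζ t‖ ≤ r) → ∀ t ∈ Set.Icc 0 T, ζ t = F t := by
    intro ζ hζ hζ0 hζg hζr t ht
    let G : C(ℝ, Metric.closedBall (0 : ℂ) r) :=
      ⟨fun t => ⟨ζ (Set.projIcc 0 T hT t), mem_closedBall_zero_iff.2 (hζr _ (Subtype.prop _))⟩,
        (hζ.comp (continuous_subtype_val.comp continuous_projIcc)).subtype_mk _⟩
    have hG : G = F := by
      refine huniq G ⟨?_, fun t => hζg _ (Subtype.prop _)⟩
      change ζ (Set.projIcc 0 T hT 0) = z₀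
      rw [Set.projIcc_left, hζ0]
    rw [← hG]
    change ζ t = ζ (Set.projIcc 0 T hT t)
    rw [Set.projIcc_of_mem hT ht]
  intro t ht
  rw [key γ hγ hγ0 hγg (fun t ht => (hC t ht).trans ((le_max_left _ _).trans hr)) t ht,
    key η hη hη0 hηg (fun t ht => (hD t ht).trans ((le_max_right _ _).trans hr)) t ht]

theorem exists_lift_ray :
    ∃ γ : ℝ → ℂ, ContinuousOn γ (Set.Ici 0) ∧ ∀ t, 0 ≤ t → g (γ t) = g z₀ - t := by
  choose γ hγ hγ0 hγg using fun n : ℕ => exists_lift_segment hg hl hz (Nat.cast_nonneg (α := ℝ) n)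
  have heq : ∀ m n : ℕ, ∀ t : ℝ, 0 ≤ t → t ≤ m → t ≤ n → γ m t = γ n t := by
    intro m n t h0 hm hn
    exact lift_segment_unique hg hl hz h0 (hγ m) (hγ n) (hγ0 m) (hγ0 n)
      (fun s hs => hγg m s ⟨hs.1, hs.2.trans hm⟩) (fun s hs => hγg n s ⟨hs.1, hs.2.trans hn⟩)
      ⟨h0, le_rfl⟩
  refine ⟨fun t => γ ⌈t⌉₊ t, fun t ht => ?_, fun t ht => hγg _ t ⟨ht, Nat.le_ceil t⟩⟩
  obtain ⟨n, hn⟩ := exists_nat_gt t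
  refine (hγ n).continuousWithinAt.congr_of_eventuallyEq ?_ (heq _ _ t ht (Nat.le_ceil t) hn.le)
  filter_upwards [self_mem_nhdsWithin, mem_nhdsWithin_of_mem_nhds (Iio_mem_nhds hn)] with s hs hsn
  exact heq _ _ s hs (Nat.le_ceil s) (le_of_lt hsn)

end RayLifting

theorem tendsto_cocompact_of_comp {g : ℂ → ℂ} (hg : Continuous g) {γ : ℝ → ℂ}
    (h : Tendsto (fun t => ‖g (γ t)‖) atTop atTop) : Tendsto γ atTop (cocompact ℂ) := by
  rw [(hasBasis_cocompact).tendsto_right_iff]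
  intro K hK
  obtain ⟨C, hC⟩ := hK.exists_bound_of_continuousOn hg.continuousOn
  filter_upwards [h.eventually_gt_atTop C] with t ht hmem
  exact (hC _ hmem).not_gt ht

/-! ### Singular values of `c * exp g` -/

namespace EntireFunction

/-- The entire function `c * exp (g z)`. -/
noncomputable def expComp (c : ℂ) (g : ℂ → ℂ) (hg : Differentiable ℂ g) : EntireFunction :=
  ⟨⟨fun z => c * Complex.exp (g z), continuous_const.mul hg.continuous.cexp⟩,
    hg.cexp.const_mul c⟩

variable {c : ℂ} {g : ℂ → ℂ} (hg : Differentiable ℂ g)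

theorem expComp_apply (z : ℂ) : (expComp c g hg).1 z = c * Complex.exp (g z) := rfl

theorem criticalValues_expComp (hc : c ≠ 0) :
    criticalValues (expComp c g hg) =
      (fun w => c * w) '' {w | ∃ z, deriv g z = 0 ∧ Complex.exp (g z) = w} := by
  have hd : ∀ z, deriv (expComp c g hg).1 z = 0 ↔ deriv g z = 0 := by
    intro z
    change deriv (fun z => c * Complex.exp (g z)) z = 0 ↔ _
    rw [deriv_const_mul_field, deriv_cexp (hg z)]
    simp [hc, Complex.exp_ne_zero]
  ext w
  constructor
  · rintro ⟨z, hz, rfl⟩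
    exact ⟨_, ⟨z, (hd z).1 hz, rfl⟩, rfl⟩
  · rintro ⟨_, ⟨z, hz, rfl⟩, rfl⟩
    exact ⟨z, (hd z).2 hz, rfl⟩

theorem zero_mem_asymptoticValues_expComp_of_lift {w : ℂ} {γ : ℝ → ℂ}
    (hγ : ContinuousOn γ (Set.Ici 0)) (hγg : ∀ t, 0 ≤ t → g (γ t) = w - t) :
    0 ∈ asymptoticValues (expComp c g hg) := by
  have hre : Tendsto (fun t => (g (γ t)).re) atTop atBot := by
    have : Tendsto (fun t : ℝ => w.re - t) atTop atBot :=
      tendsto_atBot_add_const_left _ _ tendsto_neg_atTop_atBot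
    refine this.congr' ?_
    filter_upwards [eventually_ge_atTop 0] with t ht
    simp [hγg t ht]
  refine ⟨γ, hγ, tendsto_cocompact_of_comp hg.continuous ?_, ?_⟩
  · refine tendsto_atTop_mono (fun t => ?_) (tendsto_neg_atBot_atTop.comp hre)
    exact (neg_le_abs _).trans (Complex.abs_re_le_norm _)
  · simp only [expComp_apply]
    rw [tendsto_zero_iff_norm_tendsto_zero]
    have := (Real.tendsto_exp_atBot.comp hre).const_mul ‖c‖
    rw [mul_zero] at this
    refine this.congr fun t => ?_
    rw [norm_mul, Complex.norm_exp, Function.comp_apply]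

theorem zero_mem_asymptoticValues_expComp (hl : LargeOnCircles g)
    (hcount : {w | ∃ z, deriv g z = 0 ∧ g z = w}.Countable)
    (him : (g 0).im < (g Complex.I).im) :
    0 ∈ asymptoticValues (expComp c g hg) := by
  -- Critical values have only countably many imaginary parts, so some horizontal line meeting the
  -- image of `g` misses them all.
  obtain ⟨y, hy, hyc⟩ : ∃ y ∈ Set.Icc (g 0).im (g Complex.I).im,
      y ∉ Complex.im '' {w | ∃ z, deriv g z = 0 ∧ g z = w} := by
    by_contra! h
    exact (Cardinal.Real.Icc_countable_iff.not.2 him.not_ge) ((hcount.image _).mono h)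
  obtain ⟨z₀, rfl⟩ := mem_range_of_exists_le_of_exists_ge
    (Complex.continuous_im.comp hg.continuous) ⟨0, hy.1⟩ ⟨Complex.I, hy.2⟩
  obtain ⟨γ, hγ, hγg⟩ := exists_lift_ray hg hl (z₀ := z₀) fun z t hzt h0 =>
    hyc ⟨g z, ⟨z, h0, rfl⟩, by simp [hzt]⟩
  exact zero_mem_asymptoticValues_expComp_of_lift hg hγ hγg

theorem exists_norm_eq_of_tendsto_cocompact {γ : ℝ → ℂ} {t₀ : ℝ}
    (hγ : ContinuousOn γ (Set.Ici t₀)) (hinf : Tendsto γ atTop (cocompact ℂ)) {r : ℝ}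
    (hr : ‖γ t₀‖ ≤ r) : ∃ t, t₀ ≤ t ∧ ‖γ t‖ = r := by
  have h1 : Tendsto (fun t => ‖γ t‖) atTop atTop := tendsto_norm_cocompact_atTop.comp hinf
  obtain ⟨t, ht, ht0⟩ := ((h1.eventually_ge_atTop r).and (eventually_ge_atTop t₀)).exists
  obtain ⟨s, hs, hsr⟩ := intermediate_value_Icc ht0
    ((hγ.mono Set.Icc_subset_Ici_self).norm) ⟨hr, ht⟩
  exact ⟨s, hs.1, hsr⟩

/-- Subtracting the principal logarithm of `exp φ / w`, which tends to `0`, leaves a continuous path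
in the discrete set of logarithms of `w`, eventually constant. -/
theorem bounded_of_tendsto_exp {φ : ℝ → ℂ} (hφ : ContinuousOn φ (Set.Ici 0)) {w : ℂ} (hw : w ≠ 0)
    (h : Tendsto (fun t => Complex.exp (φ t)) atTop (𝓝 w)) :
    ∃ t₀ C : ℝ, 0 ≤ t₀ ∧ ∀ t, t₀ ≤ t → ‖φ t‖ ≤ C := by
  have h1 : Tendsto (fun t => Complex.exp (φ t) / w) atTop (𝓝 1) := by
    simpa [hw] using h.div_const w
  have h2 : ∀ᶠ t in atTop, Complex.exp (φ t) / w ∈ Complex.slitPlane :=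
    h1.eventually (Complex.isOpen_slitPlane.mem_nhds Complex.one_mem_slitPlane)
  have h3 : ∀ᶠ t in atTop, ‖Complex.log (Complex.exp (φ t) / w)‖ < 1 := by
    have h := ((continuousAt_clog Complex.one_mem_slitPlane).tendsto.comp h1).norm
    rw [Complex.log_one, norm_zero] at h
    exact h.eventually_lt_const one_pos
  obtain ⟨t₁, ht₁⟩ := eventually_atTop.1 (h2.and h3)
  set t₀ := max t₁ 0
  have hsub : Set.Ici t₀ ⊆ Set.Ici (0 : ℝ) := Set.Ici_subset_Ici.2 (le_max_right _ _)
  let ψ : ℝ → ℂ := fun t => φ t - Complex.log (Complex.exp (φ t) / w)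
  have hψ : ContinuousOn ψ (Set.Ici t₀) := by
    refine (hφ.mono hsub).sub (ContinuousOn.clog ((hφ.mono hsub).cexp.div_const w) fun t ht => ?_)
    exact (ht₁ t ((le_max_left _ _).trans ht)).1
  have hexp : ∀ t, Complex.exp (ψ t) = w := fun t => by
    have := Complex.exp_ne_zero (φ t)
    rw [Complex.exp_sub, Complex.exp_log (by positivity)]
    field_simp
  have hconst : ∀ t ∈ Set.Ici t₀, ψ t = ψ t₀ := fun t ht =>
    Complex.isCoveringMap_exp.constOn_of_comp isPreconnected_Ici hψ
      (fun a _ b _ => Subtype.ext ((hexp a).trans (hexp b).symm)) ht Set.self_mem_Ici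
  refine ⟨t₀, ‖ψ t₀‖ + 1, le_max_right _ _, fun t ht => ?_⟩
  have : φ t = ψ t₀ + Complex.log (Complex.exp (φ t) / w) := by
    rw [← hconst t ht]; ring
  rw [this]
  refine (norm_add_le _ _).trans ?_
  have := (ht₁ t ((le_max_left _ _).trans ht)).2
  gcongr

theorem asymptoticValues_expComp_subset (hc : c ≠ 0) (hl : LargeOnCircles g) :
    asymptoticValues (expComp c g hg) ⊆ {0} := by
  rintro w ⟨γ, hγ, hinf, hlim⟩
  by_contra hw
  rw [Set.mem_singleton_iff] at hw
  have h1 : Tendsto (fun t => Complex.exp (g (γ t))) atTop (𝓝 (w / c)) := by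
    refine (hlim.div_const c).congr fun t => ?_
    rw [expComp_apply, mul_div_cancel_left₀ _ hc]
  obtain ⟨t₀, C, ht₀, hC⟩ := bounded_of_tendsto_exp (hg.continuous.comp_continuousOn hγ)
    (div_ne_zero hw hc) h1
  obtain ⟨r, hr, hlarge⟩ := hl (max ‖γ t₀‖ (C + 1))
  obtain ⟨t, ht, htr⟩ := exists_norm_eq_of_tendsto_cocompact
    (hγ.mono (Set.Ici_subset_Ici.2 ht₀)) hinf ((le_max_left _ _).trans hr)
  have h2 := (le_max_right _ _).trans (hlarge _ htr)
  have h3 := hC t ht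
  simp only [Function.comp_apply] at h3
  linarith

end EntireFunction

/-! ### Approximation of the exponential family -/

namespace EntireFunction

theorem singularSet_expScaled {c : ℂ} (hc : c ≠ 0) : singularSet (expScaled c) = {0} := by
  have hcrit : criticalValues (expScaled c) = ∅ := by
    refine (criticalValues_expComp (g := fun z => z) differentiable_fun_id hc).trans ?_
    simp
  have hl : LargeOnCircles fun z => z := fun M => ⟨M, le_rfl, fun z hz => hz.ge⟩
  have has : asymptoticValues (expScaled c) = {0} := by
    refine Set.Subset.antisymm (asymptoticValues_expComp_subset differentiable_fun_id hc hl) ?_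
    rw [Set.singleton_subset_iff]
    refine zero_mem_asymptoticValues_expComp_of_lift (g := fun z => z) differentiable_fun_id
      (γ := fun t => 0 - (t : ℂ)) ?_ fun t _ => rfl
    exact (continuous_const.sub Complex.continuous_ofReal).continuousOn
  rw [singularSet, hcrit, has, Set.union_empty, closure_singleton]

theorem exists_expComp_singularSet {U : Set ℂ} (hU : IsClosed U) (h0 : (0 : ℂ) ∈ U)
    (hne : (U \ {0}).Nonempty) {c : ℂ} (hc : c ≠ 0) {R δ : ℝ} (hR : 1 ≤ R) (hδ : 0 < δ) :
    ∃ (g : ℂ → ℂ) (hg : Differentiable ℂ g), (∀ z, ‖z‖ ≤ R → ‖g z - z‖ ≤ δ) ∧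
      singularSet (expComp c g hg) = U := by
  have : Nonempty ↥(U \ {0}) := hne.to_subtype
  let v := TopologicalSpace.denseSeq ↥(U \ {0})
  -- The cap `1 / 4` forces `g 0` and `g I` to have different imaginary parts, as needed for the
  -- horizontal ray.
  obtain ⟨g, hg, hnear, hl, hcount, hcrit⟩ := exists_entire_near_id (u := fun n => (v n : ℂ) / c)
    (fun n => div_ne_zero (v n).2.2 hc) R (δ := min δ (1 / 4)) (by positivity)
  refine ⟨g, hg, fun z hz => (hnear z hz).trans (min_le_left _ _), ?_⟩
  have him : (g 0).im < (g Complex.I).im := by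
    have h1 := (Complex.abs_im_le_norm _).trans
      ((hnear 0 (by simpa using zero_le_one.trans hR)).trans (min_le_right _ _))
    have h2 := (Complex.abs_im_le_norm _).trans
      ((hnear Complex.I (by simpa using hR)).trans (min_le_right _ _))
    rw [abs_le] at h1 h2
    simp only [Complex.sub_im, Complex.zero_im, Complex.I_im] at h1 h2
    linarith [h1.2, h2.1]
  have has : asymptoticValues (expComp c g hg) = {0} :=
    (asymptoticValues_expComp_subset hg hc hl).antisymm
      (Set.singleton_subset_iff.2 (zero_mem_asymptoticValues_expComp hg hl hcount him))
  have hcv : criticalValues (expComp c g hg) = Subtype.val '' Set.range v := by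
    rw [criticalValues_expComp hg hc, hcrit, ← Set.range_comp, ← Set.range_comp]
    congr 1
    funext n
    simp only [Function.comp_apply]
    field_simp
  rw [singularSet, has, hcv]
  refine Set.Subset.antisymm (closure_minimal (Set.union_subset ?_ ?_) hU) fun w hw => ?_
  · exact Set.singleton_subset_iff.2 h0
  · rintro _ ⟨x, -, rfl⟩
    exact x.2.1
  · by_cases hw0 : w = 0
    · exact subset_closure (Or.inl hw0)
    · exact closure_mono Set.subset_union_right
        (Subtype.dense_iff.1 (TopologicalSpace.denseRange_denseSeq ↥(U \ {0})) ⟨hw, hw0⟩)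

theorem tendsto_expComp {c : ℂ} {g : ℕ → ℂ → ℂ} (hg : ∀ n, Differentiable ℂ (g n))
    (h : ∀ (n : ℕ) (z : ℂ), ‖z‖ ≤ (n : ℝ) + 1 → ‖g n z - z‖ ≤ 1 / ((n : ℝ) + 1)) :
    Tendsto (fun n => expComp c (g n) (hg n)) atTop (𝓝 (expScaled c)) := by
  rw [tendsto_subtype_rng, ContinuousMap.tendsto_iff_tendstoLocallyUniformly,
    Metric.tendstoLocallyUniformly_iff]
  intro ε hε x
  refine ⟨Metric.ball x 1, Metric.ball_mem_nhds x one_pos, ?_⟩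
  have hlim : Tendsto (fun n : ℕ => ‖c‖ * (Real.exp (‖x‖ + 1) * (2 * (1 / ((n : ℝ) + 1)))))
      atTop (𝓝 0) := by
    have := ((tendsto_one_div_add_atTop_nhds_zero_nat (𝕜 := ℝ)).const_mul 2).const_mul
      (Real.exp (‖x‖ + 1)) |>.const_mul ‖c‖
    simpa using this
  filter_upwards [hlim.eventually_lt_const hε,
    tendsto_natCast_atTop_atTop.eventually_ge_atTop ‖x‖] with n hn hnx y hy
  have hyx : ‖y‖ ≤ ‖x‖ + 1 := by
    rw [mem_ball_iff_norm] at hy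
    linarith [norm_le_norm_add_norm_sub' y x]
  have hgy := h n y (by linarith)
  have hle : 1 / ((n : ℝ) + 1) ≤ 1 := by
    rw [div_le_one (by positivity)]
    linarith [Nat.cast_nonneg (α := ℝ) n]
  refine lt_of_le_of_lt ?_ hn
  have heq : c * Complex.exp (g n y) - c * Complex.exp y =
      c * (Complex.exp y * (Complex.exp (g n y - y) - 1)) := by
    rw [Complex.exp_sub]
    field_simp [Complex.exp_ne_zero y]
  rw [dist_comm, dist_eq_norm]
  change ‖c * Complex.exp (g n y) - c * Complex.exp y‖ ≤ _
  rw [heq, norm_mul, norm_mul]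
  gcongr
  · rw [Complex.norm_exp]
    exact Real.exp_le_exp.2 ((Complex.re_le_norm y).trans hyx)
  · exact (Complex.norm_exp_sub_one_le (hgy.trans hle)).trans (by gcongr)

theorem continuous_expScaled : Continuous expScaled := by
  refine Continuous.subtype_mk (ContinuousMap.continuous_of_continuous_uncurry _ ?_) _
  exact continuous_fst.mul continuous_snd.cexp

theorem expScaled_mem_closure {U : Set ℂ} (hU : IsClosed U) (h0 : (0 : ℂ) ∈ U) {c : ℂ}
    (hc : c ≠ 0) : expScaled c ∈ closure (withSingularSet U) := by
  -- If `U = {0}` there is no dense sequence to prescribe, but the exponential itself already has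
  -- singular set `U`.
  rcases (U \ {0}).eq_empty_or_nonempty with he | hne
  · refine subset_closure ?_
    rw [Set.sdiff_eq_empty] at he
    exact (singularSet_expScaled hc).trans (he.antisymm (Set.singleton_subset_iff.2 h0)).symm
  · choose g hg hnear hS using fun n : ℕ => exists_expComp_singularSet hU h0 hne hc
      (R := (n : ℝ) + 1) (δ := 1 / ((n : ℝ) + 1)) (by simp) (by positivity)
    exact mem_closure_of_tendsto (tendsto_expComp hg hnear) (Eventually.of_forall hS)

end EntireFunction

theorem mainTheorem6 (U : Set ℂ) (hU : IsClosed U) (h0 : (0 : ℂ) ∈ U) :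
    EntireFunction.expFamily ⊆ closure (EntireFunction.withSingularSet U) := by
  rintro _ ⟨c, rfl⟩
  -- The case `c = 0` follows by continuity in `c` and density of the nonzero parameters.
  have hclosed : IsClosed (EntireFunction.expScaled ⁻¹'
      closure (EntireFunction.withSingularSet U)) :=
    isClosed_closure.preimage EntireFunction.continuous_expScaled
  have hsub : ({0}ᶜ : Set ℂ) ⊆ EntireFunction.expScaled ⁻¹'
      closure (EntireFunction.withSingularSet U) := fun c hc =>
    EntireFunction.expScaled_mem_closure hU h0 hc
  exact hclosed.closure_subset_iff.2 hsub (dense_compl_singleton (0 : ℂ) c)
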